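/- Call a set $S\subseteq\{0,1\}^n$ a matroid if it is the set of indicator vectors of the bases of a matroid with ground set $\{1,\dots,n\}$, and for a matrix $W\in\{0,1\}^{2\times n}$ let $\mathrm{conv}(WS)=\mathrm{conv}\{Wx : x\in S\}\subset\mathbb{R}^2$. (1) The maximum number of vertices of $\mathrm{conv}(WS)$, over all $n\ge 0$, all matroids $S\subseteq\{0,1\}^n$ and all $W\in\{0,1\}^{2\times n}$, is exactly $8$ (the bound $8$ always holds, and it is attained). (2) There are $8$ vectors $h_1,\dots,h_8\in\mathbb{Z}^2$ such that, for every $n$, every matroid $S\subseteq\{0,1\}^n$ presented by an independence oracle (which, queried on $x\in\{0,1\}^n$, asserts whether $\mathrm{supp}(x)\subseteq\mathrm{supp}(z)$ for some $z\in S$), every $W\in\{0,1\}^{2\times n}$, and every convex function $f:\mathbb{R}^2\to\mathbb{R}$ presented by a comparison oracle (which, queried on $y,z$, asserts whether $f(y)<f(z)$), the problem $\max\{f(Wx):x\in S\}$ is solved as follows. For each $i=1,\dots,8$, the greedy algorithm (treat the elements in the order of nonincreasing weight, adding each one that keeps the set independent) is run with the weight vector $h_iW$; it makes $n$ independence queries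 and outputs an optimal solution $x_i\in S$ of the linear counterpart $\max\{(h_iW)x : x\in S\}$. Then a point among $x_1,\dots,x_8$ with the largest value $f(Wx_i)$ is selected by $7$ comparison queries; it is an optimal solution of $\max\{f(Wx):x\in S\}$. In total, $8n$ independence queries and $7$ comparison queries are made. -/

import Mathlib

namespace ConvexMatroid

/-- `S ⊆ {0,1}ⁿ` is a matroid: it is the set of indicator vectors of the bases of a matroid whose
ground set is all of `Fin n`. -/
def IsMatroid {n : ℕ} (S : Set (Fin n → ℤ)) : Prop :=
  ∃ M : Matroid (Fin n), M.E = Set.univ ∧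
    S = {x | ∃ B : Set (Fin n), M.IsBase B ∧ x = B.indicator 1}

/-- All entries of the matrix are `0` or `1`. -/
def IsBinary {n : ℕ} (W : Matrix (Fin 2) (Fin n) ℤ) : Prop :=
  ∀ i j, W i j = 0 ∨ W i j = 1

/-- An integer vector of the plane, seen in `ℝ²`. -/
def toReal (y : Fin 2 → ℤ) : Fin 2 → ℝ := fun i => (y i : ℝ)

/-- The polytope `conv(WS) = conv {W x : x ∈ S} ⊆ ℝ²`. -/
def projection {n : ℕ} (W : Matrix (Fin 2) (Fin n) ℤ) (S : Set (Fin n → ℤ)) :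
    Set (Fin 2 → ℝ) :=
  convexHull ℝ ((fun x => toReal (W.mulVec x)) '' S)

/-- The vertices of `conv(WS)`. -/
def vertices {n : ℕ} (W : Matrix (Fin 2) (Fin n) ℤ) (S : Set (Fin n → ℤ)) :
    Set (Fin 2 → ℝ) :=
  (projection W S).extremePoints ℝ

/-- `x` is an optimal solution of `max {g x : x ∈ S}`. -/
def Solves {n : ℕ} {R : Type} [LE R] (g : (Fin n → ℤ) → R) (S : Set (Fin n → ℤ))
    (x : Fin n → ℤ) : Prop :=
  x ∈ S ∧ ∀ y ∈ S, g y ≤ g x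

/-- `o` is an independence oracle for `S`: queried on `x ∈ {0,1}ⁿ`, it asserts whether
`supp x ⊆ supp z` for some `z ∈ S`. Nothing is required on other queries. -/
def IsIndependenceOracle {n : ℕ} (S : Set (Fin n → ℤ)) (o : (Fin n → ℤ) → Bool) : Prop :=
  ∀ x : Fin n → ℤ, (∀ i, x i = 0 ∨ x i = 1) →
    (o x = true ↔ ∃ z ∈ S, Function.support x ⊆ Function.support z)

/-- `c` is a comparison oracle for `f`: queried on `y, z`, it asserts whether `f y < f z`
(queries at integer points are enough here). -/
def IsComparisonOracle (f : (Fin 2 → ℝ) → ℝ) (c : (Fin 2 → ℤ) → (Fin 2 → ℤ) → Bool) : Prop :=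
  ∀ y z : Fin 2 → ℤ, c y z = true ↔ f (toReal y) < f (toReal z)

/-- Programs that reach the matroid and the function only by queries to an independence oracle
(`askIndep x`) and to a comparison oracle (`askLess y z`), and continue according to the answer. -/
inductive Program (n : ℕ) (α : Type) : Type where
  | done (a : α) : Program n α
  | askIndep (x : Fin n → ℤ) (k : Bool → Program n α) : Program n α
  | askLess (y z : Fin 2 → ℤ) (k : Bool → Program n α) : Program n α

namespace Program

/-- Sequential composition of programs. -/
def bind {n : ℕ} {α β : Type} : Program n α → (α → Program n β) → Program n β
  | done a, g => g a
  | askIndep x k, g => askIndep x fun b => (k b).bind g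
  | askLess y z k, g => askLess y z fun b => (k b).bind g

/-- The output of a program that is run with the oracles `o` and `c`. -/
def output {n : ℕ} {α : Type} (o : (Fin n → ℤ) → Bool) (c : (Fin 2 → ℤ) → (Fin 2 → ℤ) → Bool) :
    Program n α → α
  | done a => a
  | askIndep x k => (k (o x)).output o c
  | askLess y z k => (k (c y z)).output o c

/-- The number of independence queries made when a program is run with the oracles `o`, `c`. -/
def indepQueries {n : ℕ} {α : Type} (o : (Fin n → ℤ) → Bool)
    (c : (Fin 2 → ℤ) → (Fin 2 → ℤ) → Bool) : Program n α → ℕ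
  | done _ => 0
  | askIndep x k => (k (o x)).indepQueries o c + 1
  | askLess y z k => (k (c y z)).indepQueries o c

/-- The number of comparison queries made when a program is run with the oracles `o`, `c`. -/
def lessQueries {n : ℕ} {α : Type} (o : (Fin n → ℤ) → Bool)
    (c : (Fin 2 → ℤ) → (Fin 2 → ℤ) → Bool) : Program n α → ℕ
  | done _ => 0
  | askIndep x k => (k (o x)).lessQueries o c
  | askLess y z k => (k (c y z)).lessQueries o c + 1

end Program

/-- The greedy loop: run through the listed elements, and add each one to the current set
(given by its indicator vector `x`) whenever the result is independent. -/
def greedyLoop {n : ℕ} : List (Fin n) → (Fin n → ℤ) → Program n (Fin n → ℤ)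
  | [], x => .done x
  | i :: l, x =>
      .askIndep (Function.update x i 1) fun b =>
        greedyLoop l (if b then Function.update x i 1 else x)

/-- The greedy algorithm for `max {w x : x ∈ S}`: start with the empty set and treat the elements
of the ground set in the order of nonincreasing weight. -/
def greedy {n : ℕ} (w : Fin n → ℤ) : Program n (Fin n → ℤ) :=
  greedyLoop ((List.finRange n).insertionSort fun i j => w j ≤ w i) 0

/-- Run the greedy algorithm once for every `h` in the list `H`, on the linear counterpart
`max {(hW) x : x ∈ S}`, and collect the outputs. -/
def solveCounterparts {n : ℕ} (W : Matrix (Fin 2) (Fin n) ℤ) :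
    List (Fin 2 → ℤ) → Program n (List (Fin n → ℤ))
  | [] => .done []
  | h :: H =>
      (greedy (Matrix.vecMul h W)).bind fun x =>
        (solveCounterparts W H).bind fun l => .done (x :: l)

/-- Pick a point of `x :: l` with the best value `f (W x)`, using comparisons only. -/
def pickBest {n : ℕ} (W : Matrix (Fin 2) (Fin n) ℤ) :
    (Fin n → ℤ) → List (Fin n → ℤ) → Program n (Fin n → ℤ)
  | x, [] => .done x
  | x, y :: l =>
      .askLess (W.mulVec x) (W.mulVec y) fun b => pickBest W (if b then y else x) l

/-- The algorithm for `max {f (W x) : x ∈ S}`: greedily solve the linear counterparts given by the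
list `H`, and output the best of the points that were found (for empty `H`, a dummy value). -/
def convexMax {n : ℕ} (H : List (Fin 2 → ℤ)) (W : Matrix (Fin 2) (Fin n) ℤ) :
    Program n (Fin n → ℤ) :=
  (solveCounterparts W H).bind fun
    | [] => .done 0
    | x :: l => pickBest W x l

end ConvexMatroid

/-! Greedy uses the weights only to order the ground set, so its output is optimal for every weight
that is weakly monotone along that order. For the weight `hW` the order depends on the signs of `h`
on differences of columns, and for binary `W` these lie in {-1,0,1}². The four lines orthogonal to
such differences cut the plane into eight cones. A vector interior to a cone has strict signs on
nonzero differences, so its order suits every functional in the closed cone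
(`exists_direction_monotone`).

Hence eight greedy points maximize all linear functionals on `WS`, and by separation their hull is
`conv(WS)` (`projection_subset_convexHull_greedyPoint`). This bounds the number of vertices by 8,
and a convex `f` attains its maximum over the hull at one of these points. A uniform matroid shows
that 8 is attained. -/

namespace ConvexMatroid

/-! ### Outputs and query counts of composed programs -/

namespace Program

variable {n : ℕ} {α β : Type} (o : (Fin n → ℤ) → Bool) (c : (Fin 2 → ℤ) → (Fin 2 → ℤ) → Bool)

lemma output_bind (p : Program n α) (g : α → Program n β) :
    (p.bind g).output o c = (g (p.output o c)).output o c := by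
  induction p with
  | done a => rfl
  | askIndep x k ih => exact ih _
  | askLess y z k ih => exact ih _

lemma indepQueries_bind (p : Program n α) (g : α → Program n β) :
    (p.bind g).indepQueries o c =
      p.indepQueries o c + (g (p.output o c)).indepQueries o c := by
  induction p with
  | done a => simp [bind, output, indepQueries]
  | askIndep x k ih => simp only [bind, output, indepQueries, ih]; omega
  | askLess y z k ih => simp only [bind, output, indepQueries, ih]

lemma lessQueries_bind (p : Program n α) (g : α → Program n β) :
    (p.bind g).lessQueries o c =
      p.lessQueries o c + (g (p.output o c)).lessQueries o c := by
  induction p with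
  | done a => simp [bind, output, lessQueries]
  | askIndep x k ih => simp only [bind, output, lessQueries, ih]
  | askLess y z k ih => simp only [bind, output, lessQueries, ih]; omega

end Program

/-! ### Correctness of the greedy algorithm -/

section Greedy

variable {n : ℕ} (o : (Fin n → ℤ) → Bool) (c : (Fin 2 → ℤ) → (Fin 2 → ℤ) → Bool)

lemma greedyLoop_queries (l : List (Fin n)) (x : Fin n → ℤ) :
    (greedyLoop l x).indepQueries o c = l.length ∧ (greedyLoop l x).lessQueries o c = 0 := by
  induction l generalizing x with
  | nil => exact ⟨rfl, rfl⟩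
  | cons i l ih =>
    simp only [greedyLoop, Program.indepQueries, Program.lessQueries, ih, List.length_cons,
      and_self]

lemma greedy_queries (w : Fin n → ℤ) :
    (greedy w).indepQueries o c = n ∧ (greedy w).lessQueries o c = 0 := by
  simp [greedy, greedyLoop_queries]

variable {W : Matrix (Fin 2) (Fin n) ℤ}

lemma solveCounterparts_output (H : List (Fin 2 → ℤ)) :
    (solveCounterparts W H).output o c =
      H.map fun h => (greedy (Matrix.vecMul h W)).output o c := by
  induction H with
  | nil => rfl
  | cons h H ih =>
    simp only [solveCounterparts, Program.output_bind, ih, Program.output, List.map_cons]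

lemma solveCounterparts_queries (H : List (Fin 2 → ℤ)) :
    (solveCounterparts W H).indepQueries o c = H.length * n ∧
      (solveCounterparts W H).lessQueries o c = 0 := by
  induction H with
  | nil => simp [solveCounterparts, Program.indepQueries, Program.lessQueries]
  | cons h H ih =>
    simp only [solveCounterparts, Program.indepQueries_bind, Program.lessQueries_bind, ih,
      greedy_queries, Program.indepQueries, Program.lessQueries, List.length_cons]
    exact ⟨by ring, trivial⟩

lemma pickBest_queries (x : Fin n → ℤ) (l : List (Fin n → ℤ)) :
    (pickBest W x l).indepQueries o c = 0 ∧ (pickBest W x l).lessQueries o c = l.length := by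
  induction l generalizing x with
  | nil => exact ⟨rfl, rfl⟩
  | cons y l ih =>
    simp only [pickBest, Program.indepQueries, Program.lessQueries, ih, List.length_cons,
      and_self]

lemma pickBest_output {f : (Fin 2 → ℝ) → ℝ} {c : (Fin 2 → ℤ) → (Fin 2 → ℤ) → Bool}
    (hc : IsComparisonOracle f c) (x : Fin n → ℤ) (l : List (Fin n → ℤ)) :
    (pickBest W x l).output o c ∈ x :: l ∧
      ∀ y ∈ x :: l, f (toReal (W.mulVec y)) ≤
        f (toReal (W.mulVec ((pickBest W x l).output o c))) := by
  induction l generalizing x with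
  | nil => simp [pickBest, Program.output]
  | cons y l ih =>
    have hxy := hc (W.mulVec x) (W.mulVec y)
    simp only [pickBest, Program.output]
    obtain ⟨hmem, hmax⟩ := ih (if c (W.mulVec x) (W.mulVec y) = true then y else x)
    refine ⟨?_, ?_⟩
    · revert hmem
      split_ifs <;> simp only [List.mem_cons] <;> tauto
    -- The final point is at least as good as the winner of the first comparison, hence as both of
    -- its contestants.
    · have key := hmax _ List.mem_cons_self
      intro z hz
      rcases List.mem_cons.1 hz with rfl | hz
      · refine le_trans ?_ key
        split_ifs with h
        · exact (hxy.1 h).le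
        · exact le_rfl
      rcases List.mem_cons.1 hz with rfl | hz
      · refine le_trans ?_ key
        split_ifs with h
        · exact le_rfl
        · exact not_lt.1 fun h' => h (hxy.2 h')
      · exact hmax z (List.mem_cons_of_mem _ hz)

/-- Extend `insert i A` to a base using elements of `B`. If `i ∉ B`, equicardinality of bases forces
exactly one `j` to leave; it lies outside `A`, so the weight changes by `w i - w j ≥ 0`. -/
lemma exists_isBase_insert_weight_le {α : Type*} [Fintype α] {M : Matroid α} {A B : Set α} {i : α}
    (hB : M.IsBase B) (hA : M.Indep (insert i A)) (hAB : A ⊆ B) (w : α → ℝ)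
    (hw : ∀ j ∈ B, j ∉ A → w j ≤ w i) :
    ∃ B', M.IsBase B' ∧ insert i A ⊆ B' ∧ B' ⊆ insert i B ∧
      ∑ j, B.indicator w j ≤ ∑ j, B'.indicator w j := by
  classical
  by_cases hi : i ∈ B
  · exact ⟨B, hB, Set.insert_subset hi hAB, Set.subset_insert _ _, le_rfl⟩
  obtain ⟨B', hB', h1, h2⟩ := hA.exists_isBase_subset_union_isBase hB
  have h2' : B' ⊆ insert i B := by
    intro x hx
    rcases h2 hx with (rfl | h) | h
    · simp
    · exact Or.inr (hAB h)
    · exact Or.inr h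
  have hiB' : i ∈ B' := h1 (Set.mem_insert _ _)
  have hd : B' \ B = {i} := by
    ext x
    constructor
    · rintro ⟨hx, hxB⟩
      exact (h2' hx).resolve_right hxB
    · rintro rfl
      exact ⟨hiB', hi⟩
  have hcard := hB.encard_sdiff_comm hB'
  rw [hd, Set.encard_singleton, Set.encard_eq_one] at hcard
  obtain ⟨j, hj⟩ := hcard
  have hjB : j ∈ B ∧ j ∉ B' := hj.symm.subset rfl
  have hij : i ≠ j := fun h => hjB.2 (h ▸ hiB')
  refine ⟨B', hB', h1, h2', ?_⟩
  have heq : ∀ x, B'.indicator w x = B.indicator w x + (if x = i then w i else 0)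
      - (if x = j then w j else 0) := by
    intro x
    by_cases hxi : x = i
    · subst hxi
      simp [hiB', hi, hij]
    by_cases hxj : x = j
    · subst hxj
      simp [hjB.1, hjB.2, hxi]
    have hiff : x ∈ B' ↔ x ∈ B :=
      ⟨fun h => (h2' h).resolve_left hxi, fun h => by_contra fun h' => hxj (hj.subset ⟨h, h'⟩)⟩
    simp [Set.indicator, hiff, hxi, hxj]
  simp only [heq, Finset.sum_sub_distrib, Finset.sum_add_distrib, Finset.sum_ite_eq',
    Finset.mem_univ, if_true]
  have := hw j hjB.1 fun h => hjB.2 (h1 (Or.inr h))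
  linarith

/-- The indicator vectors of the bases of a matroid. -/
def baseVectors {n : ℕ} (M : Matroid (Fin n)) : Set (Fin n → ℤ) :=
  {x | ∃ B : Set (Fin n), M.IsBase B ∧ x = B.indicator 1}

lemma update_indicator_one {n : ℕ} (A : Set (Fin n)) (i : Fin n) :
    Function.update (A.indicator (1 : Fin n → ℤ)) i 1 = (insert i A).indicator 1 := by
  classical
  ext j
  by_cases h : j = i
  · subst h; simp
  · simp [h, Set.indicator]

lemma oracle_indicator_iff {M : Matroid (Fin n)} {o : (Fin n → ℤ) → Bool}
    (ho : IsIndependenceOracle (baseVectors M) o) (A : Set (Fin n)) :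
    o (A.indicator 1) = true ↔ M.Indep A := by
  classical
  rw [ho _ fun i => by by_cases h : i ∈ A <;> simp [h], Matroid.indep_iff]
  constructor
  · rintro ⟨_, ⟨B, hB, rfl⟩, h⟩
    refine ⟨B, hB, ?_⟩
    simpa [Set.support_indicator] using h
  · rintro ⟨B, hB, h⟩
    refine ⟨_, ⟨B, hB, rfl⟩, ?_⟩
    simpa [Set.support_indicator] using h

/-- The loop invariant is a base that contains the current set `A` and otherwise uses only untreated
elements. Accepting `i` exchanges it for a base at least as heavy; a rejected `i` cannot lie in it.
-/
lemma greedyLoop_output {M : Matroid (Fin n)} {o : (Fin n → ℤ) → Bool}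
    (ho : IsIndependenceOracle (baseVectors M) o) (l : List (Fin n)) (A B : Set (Fin n))
    (w : Fin n → ℝ) (hl : l.Pairwise fun i j => w j ≤ w i) (hB : M.IsBase B) (hAB : A ⊆ B)
    (hBl : ∀ i ∈ B, i ∈ A ∨ i ∈ l) :
    ∃ B', M.IsBase B' ∧ (greedyLoop l (A.indicator 1)).output o c = B'.indicator 1 ∧
      ∑ i, B.indicator w i ≤ ∑ i, B'.indicator w i := by
  induction l generalizing A B with
  | nil =>
    have : A = B := hAB.antisymm fun i hi => by simpa using hBl i hi
    subst this
    exact ⟨A, hB, rfl, le_rfl⟩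
  | cons i l ih =>
    rw [List.pairwise_cons] at hl
    simp only [greedyLoop, Program.output]
    rw [update_indicator_one]
    by_cases hi : M.Indep (insert i A)
    · rw [if_pos ((oracle_indicator_iff ho _).2 hi)]
      obtain ⟨B₁, hB₁, h1, h2, h3⟩ := exists_isBase_insert_weight_le hB hi hAB w (by
        intro j hj hjA
        rcases hBl j hj with h | h
        · exact absurd h hjA
        rcases List.mem_cons.1 h with rfl | h
        · exact le_rfl
        · exact hl.1 j h)
      obtain ⟨B₂, hB₂, h4, h5⟩ := ih (insert i A) B₁ hl.2 hB₁ h1 (by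
        intro j hj
        rcases h2 hj with rfl | hj
        · simp
        rcases hBl j hj with h | h
        · simp [h]
        rcases List.mem_cons.1 h with rfl | h
        · simp
        · exact Or.inr h)
      exact ⟨B₂, hB₂, h4, h3.trans h5⟩
    · rw [if_neg fun h => hi ((oracle_indicator_iff ho _).1 h)]
      refine ih A B hl.2 hB hAB fun j hj => ?_
      rcases hBl j hj with h | h
      · exact Or.inl h
      rcases List.mem_cons.1 h with rfl | h
      · exact absurd (hB.indep.subset (Set.insert_subset hj hAB)) hi
      · exact Or.inr h

/-- The greedy output is optimal for every weight that is compatible with the greedy order. -/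
lemma greedy_optimal {M : Matroid (Fin n)} {o : (Fin n → ℤ) → Bool}
    (ho : IsIndependenceOracle (baseVectors M) o) (v : Fin n → ℤ) (w : Fin n → ℝ)
    (hvw : ∀ i j, v j ≤ v i → w j ≤ w i) {y : Fin n → ℤ} (hy : y ∈ baseVectors M) :
    (greedy v).output o c ∈ baseVectors M ∧
      ∑ i, w i * y i ≤ ∑ i, w i * (greedy v).output o c i := by
  obtain ⟨B, hB, rfl⟩ := hy
  have : IsTrans (Fin n) fun i j => v j ≤ v i := ⟨fun _ _ _ h1 h2 => h2.trans h1⟩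
  have : Std.Total fun i j : Fin n => v j ≤ v i := ⟨fun i j => le_total _ _⟩
  have hsort := List.pairwise_insertionSort (fun i j => v j ≤ v i) (List.finRange n)
  obtain ⟨B', hB', h1, h2⟩ := greedyLoop_output c ho _ ∅ B w
    (hsort.imp fun h => hvw _ _ h) hB (Set.empty_subset _) (by simp)
  rw [Set.indicator_empty'] at h1
  have hsum : ∀ C : Set (Fin n),
      ∑ i, w i * ((C.indicator (1 : Fin n → ℤ) i : ℤ) : ℝ) = ∑ i, C.indicator w i := by
    classical
    intro C
    refine Finset.sum_congr rfl fun i _ => ?_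
    by_cases h : i ∈ C <;> simp [h]
  refine ⟨⟨B', hB', h1⟩, ?_⟩
  rw [show (greedy v).output o c = B'.indicator 1 from h1, hsum, hsum]
  exact h2

end Greedy

end ConvexMatroid

/-! ### Eight directions and the upper bound -/

namespace ConvexMatroid

/-- One vector in the interior of each cone of the arrangement of the lines orthogonal to the
differences of the vectors of `{0,1}²`. -/
def directions : List (Fin 2 → ℤ) :=
  [![2, 1], ![1, 2], ![-1, 2], ![-2, 1], ![-2, -1], ![-1, -2], ![1, -2], ![2, -1]]

lemma exists_direction_monotone (a b : ℝ) :
    ∃ h ∈ directions, ∀ (n : ℕ) (W : Matrix (Fin 2) (Fin n) ℤ), IsBinary W → ∀ i j,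
      Matrix.vecMul h W j ≤ Matrix.vecMul h W i →
        a * W 0 j + b * W 1 j ≤ a * W 0 i + b * W 1 i := by
  -- Monotonicity only concerns column differences `(s, t)`, which are independent of `n` and `W`.
  have key : ∀ p q : ℤ, ![p, q] ∈ directions →
      (∀ s t : ℤ, (s = -1 ∨ s = 0 ∨ s = 1) → (t = -1 ∨ t = 0 ∨ t = 1) → p * s + q * t ≤ 0 →
        a * s + b * t ≤ 0) →
      ∃ h ∈ directions, ∀ (n : ℕ) (W : Matrix (Fin 2) (Fin n) ℤ), IsBinary W → ∀ i j,
        Matrix.vecMul h W j ≤ Matrix.vecMul h W i →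
          a * W 0 j + b * W 1 j ≤ a * W 0 i + b * W 1 i := by
    intro p q hpq H
    refine ⟨_, hpq, fun n W hW i j hij => ?_⟩
    simp only [Matrix.vecMul, dotProduct, Fin.sum_univ_two, Matrix.cons_val_zero,
      Matrix.cons_val_one] at hij
    have := H (W 0 j - W 0 i) (W 1 j - W 1 i)
      (by rcases hW 0 i with h | h <;> rcases hW 0 j with h' | h' <;> simp [h, h'])
      (by rcases hW 1 i with h | h <;> rcases hW 1 j with h' | h' <;> simp [h, h'])
      (by linarith)
    push_cast at this
    linarith
  have solve : ∀ p q : ℤ, ![p, q] ∈ directions →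
      (p * 1 + q * 0 ≤ 0 → a ≤ 0) → (p * (-1) + q * 0 ≤ 0 → -a ≤ 0) →
      (p * 0 + q * 1 ≤ 0 → b ≤ 0) → (p * 0 + q * (-1) ≤ 0 → -b ≤ 0) →
      (p * 1 + q * 1 ≤ 0 → a + b ≤ 0) → (p * (-1) + q * (-1) ≤ 0 → -a - b ≤ 0) →
      (p * 1 + q * (-1) ≤ 0 → a - b ≤ 0) → (p * (-1) + q * 1 ≤ 0 → -a + b ≤ 0) →
      ∃ h ∈ directions, ∀ (n : ℕ) (W : Matrix (Fin 2) (Fin n) ℤ), IsBinary W → ∀ i j,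
        Matrix.vecMul h W j ≤ Matrix.vecMul h W i →
          a * W 0 j + b * W 1 j ≤ a * W 0 i + b * W 1 i := by
    intro p q hpq h1 h2 h3 h4 h5 h6 h7 h8
    refine key p q hpq fun s t hs ht h => ?_
    rcases hs with rfl | rfl | rfl <;> rcases ht with rfl | rfl | rfl <;>
      push_cast
    · linarith [h6 h]
    · linarith [h2 h]
    · linarith [h8 h]
    · linarith [h4 h]
    · simp
    · linarith [h3 h]
    · linarith [h7 h]
    · linarith [h1 h]
    · linarith [h5 h]
  -- The signs of `a`, `b` and the comparison of their absolute values locate the cone.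
  rcases le_total 0 a with ha | ha <;> rcases le_total 0 b with hb | hb
  · rcases le_total a b with h | h
    · refine solve 1 2 (by decide) ?_ ?_ ?_ ?_ ?_ ?_ ?_ ?_ <;> intro h' <;> linarith
    · refine solve 2 1 (by decide) ?_ ?_ ?_ ?_ ?_ ?_ ?_ ?_ <;> intro h' <;> linarith
  · rcases le_total a (-b) with h | h
    · refine solve 1 (-2) (by decide) ?_ ?_ ?_ ?_ ?_ ?_ ?_ ?_ <;> intro h' <;> linarith
    · refine solve 2 (-1) (by decide) ?_ ?_ ?_ ?_ ?_ ?_ ?_ ?_ <;> intro h' <;> linarith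
  · rcases le_total (-a) b with h | h
    · refine solve (-1) 2 (by decide) ?_ ?_ ?_ ?_ ?_ ?_ ?_ ?_ <;> intro h' <;> linarith
    · refine solve (-2) 1 (by decide) ?_ ?_ ?_ ?_ ?_ ?_ ?_ ?_ <;> intro h' <;> linarith
  · rcases le_total a b with h | h
    · refine solve (-2) (-1) (by decide) ?_ ?_ ?_ ?_ ?_ ?_ ?_ ?_ <;> intro h' <;> linarith
    · refine solve (-1) (-2) (by decide) ?_ ?_ ?_ ?_ ?_ ?_ ?_ ?_ <;> intro h' <;> linarith

/-- The image of the greedy solution of the linear counterpart given by `h`. -/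
def greedyPoint {n : ℕ} (W : Matrix (Fin 2) (Fin n) ℤ) (o : (Fin n → ℤ) → Bool)
    (c : (Fin 2 → ℤ) → (Fin 2 → ℤ) → Bool) (h : Fin 2 → ℤ) : Fin 2 → ℝ :=
  toReal (W.mulVec ((greedy (Matrix.vecMul h W)).output o c))

lemma dual_toReal_mulVec {n : ℕ} (W : Matrix (Fin 2) (Fin n) ℤ) (φ : StrongDual ℝ (Fin 2 → ℝ))
    (x : Fin n → ℤ) :
    φ (toReal (W.mulVec x)) =
      ∑ i, (φ (Pi.single 0 1) * W 0 i + φ (Pi.single 1 1) * W 1 i) * x i := by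
  have h : ∀ y : Fin 2 → ℝ, φ y = φ (Pi.single 0 1) * y 0 + φ (Pi.single 1 1) * y 1 := by
    intro y
    have hy : y = y 0 • Pi.single 0 1 + y 1 • Pi.single 1 1 := by
      ext i
      fin_cases i <;> simp
    conv_lhs => rw [hy]
    simp only [map_add, map_smul, smul_eq_mul]
    ring
  rw [h]
  simp only [toReal, Matrix.mulVec, dotProduct, Int.cast_sum, Int.cast_mul, Finset.mul_sum,
    ← Finset.sum_add_distrib]
  exact Finset.sum_congr rfl fun i _ => by ring

/-- A point `Wx` outside the hull would be strictly separated from it by some `φ`, but the greedy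
point for the cone of `φ` has at least the `φ`-value of `Wx`. -/
lemma projection_subset_convexHull_greedyPoint {n : ℕ} {M : Matroid (Fin n)}
    {W : Matrix (Fin 2) (Fin n) ℤ} {o : (Fin n → ℤ) → Bool}
    (c : (Fin 2 → ℤ) → (Fin 2 → ℤ) → Bool) (hW : IsBinary W)
    (ho : IsIndependenceOracle (baseVectors M) o) :
    projection W (baseVectors M) ⊆
      convexHull ℝ (greedyPoint W o c '' {h | h ∈ directions}) := by
  refine convexHull_min ?_ (convex_convexHull ℝ _)
  rintro _ ⟨x, hx, rfl⟩
  by_contra hnot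
  have hfin : (greedyPoint W o c '' {h | h ∈ directions}).Finite :=
    (List.finite_toSet directions).image _
  obtain ⟨φ, u, h1, h2⟩ := geometric_hahn_banach_closed_point (convex_convexHull ℝ _)
    (hfin.isCompact_convexHull ℝ).isClosed hnot
  obtain ⟨h, hh, hmono⟩ := exists_direction_monotone (φ (Pi.single 0 1)) (φ (Pi.single 1 1))
  have h3 := (greedy_optimal c ho (Matrix.vecMul h W) _ (hmono n W hW) hx).2
  rw [← dual_toReal_mulVec, ← dual_toReal_mulVec] at h3
  have h4 := h1 _ (subset_convexHull ℝ _ ⟨h, hh, rfl⟩)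
  simp only [greedyPoint] at h4
  linarith

open Classical in
lemma encard_vertices_le {n : ℕ} (M : Matroid (Fin n)) {W : Matrix (Fin 2) (Fin n) ℤ}
    (hW : IsBinary W) : (vertices W (baseVectors M)).encard ≤ 8 := by
  let o : (Fin n → ℤ) → Bool := fun x =>
    decide (∃ z ∈ baseVectors M, Function.support x ⊆ Function.support z)
  -- Any `c` will do: greedy makes no comparison queries.
  let c : (Fin 2 → ℤ) → (Fin 2 → ℤ) → Bool := fun _ _ => false
  have ho : IsIndependenceOracle (baseVectors M) o := fun x _ => by simp [o]
  have hsub : greedyPoint W o c '' {h | h ∈ directions} ⊆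
      (fun x => toReal (W.mulVec x)) '' baseVectors M := by
    rintro _ ⟨h, -, rfl⟩
    obtain ⟨B, hB⟩ := M.exists_isBase
    exact ⟨_, (greedy_optimal c ho (Matrix.vecMul h W) (fun i => ((Matrix.vecMul h W i : ℤ) : ℝ))
      (fun i j hij => by exact_mod_cast hij) ⟨B, hB, rfl⟩).1, rfl⟩
  have heq : projection W (baseVectors M) =
      convexHull ℝ (greedyPoint W o c '' {h | h ∈ directions}) :=
    (projection_subset_convexHull_greedyPoint c hW ho).antisymm (convexHull_mono hsub)
  have hv : vertices W (baseVectors M) ⊆ greedyPoint W o c '' {h | h ∈ directions} := by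
    rw [vertices, heq]
    exact extremePoints_convexHull_subset
  refine (Set.encard_le_encard hv).trans ((Set.encard_image_le _ _).trans ?_)
  have : {h | h ∈ directions} = (directions.toFinset : Set (Fin 2 → ℤ)) := by
    ext; simp
  rw [this, Set.encard_coe_eq_coe_finsetCard]
  exact_mod_cast List.toFinset_card_le directions

end ConvexMatroid

/-! ### The octagon attaining the bound -/

namespace ConvexMatroid

lemma isMatroid_uniform {n r : ℕ} (hr : r ≤ n) :
    IsMatroid {x : Fin n → ℤ | (∀ i, x i = 0 ∨ x i = 1) ∧ ∑ i, x i = r} := by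
  classical
  let M : Matroid (Fin n) := (IndepMatroid.ofFinite (E := Set.univ) Set.finite_univ
    (fun I => I.ncard ≤ r) (by simp)
    (fun I J hJ hIJ => (Set.ncard_le_ncard hIJ).trans hJ)
    (fun I J _ hJ hIJ => by
      obtain ⟨e, heJ, heI⟩ := Set.exists_mem_notMem_of_ncard_lt_ncard hIJ
      refine ⟨e, heJ, heI, ?_⟩
      rw [Set.ncard_insert_of_notMem heI]
      omega)
    (fun I _ => Set.subset_univ I)).matroid
  have hindep : ∀ I, M.Indep I ↔ I.ncard ≤ r := fun I => Iff.rfl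
  have hbase : ∀ B, M.IsBase B ↔ B.ncard = r := by
    intro B
    rw [Matroid.isBase_iff_maximal_indep]
    constructor
    · intro h
      have hB := (hindep B).1 h.prop
      by_contra hne
      obtain ⟨e, he⟩ : ∃ e, e ∉ B := by
        by_contra! hall
        have : B = Set.univ := Set.eq_univ_of_forall hall
        subst this
        rw [Set.ncard_univ, Nat.card_fin] at hB hne
        omega
      have hins : M.Indep (insert e B) := by
        rw [hindep, Set.ncard_insert_of_notMem he]
        omega
      exact he (h.le_of_ge hins (Set.subset_insert e B) (Set.mem_insert e B))
    · intro h
      refine ⟨(hindep B).2 h.le, fun J hJ hBJ => ?_⟩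
      exact (Set.eq_of_subset_of_ncard_le hBJ (((hindep J).1 hJ).trans h.ge)).ge
  refine ⟨M, rfl, ?_⟩
  ext x
  simp only [Set.mem_ofPred_eq, hbase]
  constructor
  · rintro ⟨h01, hsum⟩
    have hx : x = {i | x i = 1}.indicator 1 := by
      ext i
      rcases h01 i with h | h <;> simp [Set.indicator, h]
    refine ⟨{i | x i = 1}, ?_, hx⟩
    rw [hx, Finset.sum_indicator_eq_sum_filter] at hsum
    rw [Set.ncard_eq_toFinset_card']
    simpa using hsum
  · rintro ⟨B, hB, rfl⟩
    refine ⟨fun i => by by_cases h : i ∈ B <;> simp [h], ?_⟩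
    rw [Finset.sum_indicator_eq_sum_filter]
    rw [Set.ncard_eq_toFinset_card'] at hB
    simp only [Pi.one_apply, Finset.sum_const, nsmul_one, Nat.cast_inj]
    rw [← hB]
    congr 1
    ext i
    simp

lemma toReal_injective : Function.Injective toReal := by
  intro y z h
  ext i
  have := congrFun h i
  simp only [toReal] at this
  exact_mod_cast this

/-- A point at which two independent linear functions are maximal is a vertex. -/
lemma toReal_mulVec_mem_vertices {n : ℕ} {W : Matrix (Fin 2) (Fin n) ℤ} {S : Set (Fin n → ℤ)}
    {x : Fin n → ℤ} (hx : x ∈ S) (u v : Fin 2 → ℤ) (huv : u 0 * v 1 - u 1 * v 0 ≠ 0)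
    (hu : ∀ y ∈ S, u ⬝ᵥ W.mulVec y ≤ u ⬝ᵥ W.mulVec x)
    (hv : ∀ y ∈ S, v ⬝ᵥ W.mulVec y ≤ v ⬝ᵥ W.mulVec x) :
    toReal (W.mulVec x) ∈ vertices W S := by
  set p := toReal (W.mulVec x) with hp
  have hle : ∀ t : Fin 2 → ℤ, (∀ y ∈ S, t ⬝ᵥ W.mulVec y ≤ t ⬝ᵥ W.mulVec x) →
      ∀ z ∈ projection W S, toReal t ⬝ᵥ z ≤ toReal t ⬝ᵥ p := by
    intro t ht z hz
    have hconv : Convex ℝ {z : Fin 2 → ℝ | toReal t ⬝ᵥ z ≤ toReal t ⬝ᵥ p} :=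
      convex_halfSpace_le ⟨fun a b => dotProduct_add _ a b, fun r a => dotProduct_smul r _ a⟩ _
    refine convexHull_min ?_ hconv hz
    rintro _ ⟨y, hy, rfl⟩
    have := ht y hy
    simp only [dotProduct, Fin.sum_univ_two] at this
    simp only [Set.mem_ofPred_eq, dotProduct, Fin.sum_univ_two, hp, toReal]
    exact_mod_cast this
  have heq : ∀ t : Fin 2 → ℤ, (∀ y ∈ S, t ⬝ᵥ W.mulVec y ≤ t ⬝ᵥ W.mulVec x) →
      ∀ y ∈ projection W S, ∀ z ∈ projection W S, p ∈ openSegment ℝ y z →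
        toReal t ⬝ᵥ y = toReal t ⬝ᵥ p := by
    intro t ht y hy z hz hyz
    obtain ⟨a, b, ha, hb, hab, h⟩ := hyz
    have h1 := hle t ht y hy
    have h2 := hle t ht z hz
    refine h1.antisymm ?_
    have h3 : toReal t ⬝ᵥ p = a * (toReal t ⬝ᵥ y) + b * (toReal t ⬝ᵥ z) := by
      rw [← h, dotProduct_add, dotProduct_smul, dotProduct_smul, smul_eq_mul, smul_eq_mul]
    have h4 : toReal t ⬝ᵥ p = a * (toReal t ⬝ᵥ p) + b * (toReal t ⬝ᵥ p) := by
      rw [← add_mul, hab, one_mul]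
    have h5 := mul_le_mul_of_nonneg_left h2 hb.le
    exact le_of_mul_le_mul_left (by linarith) ha
  refine ⟨subset_convexHull ℝ _ ⟨x, hx, rfl⟩, fun y hy z hz hyz => ?_⟩
  have h1 := heq u hu y hy z hz hyz
  have h2 := heq v hv y hy z hz hyz
  simp only [dotProduct, Fin.sum_univ_two, toReal] at h1 h2
  have hdet : ((u 0 : ℝ) * v 1 - u 1 * v 0) ≠ 0 := by exact_mod_cast huv
  -- Two independent functionals agree on `y` and `p`; Cramer's rule gives `y = p`.
  ext i
  fin_cases i
  · refine mul_left_cancel₀ hdet ?_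
    simp only [Fin.zero_eta]
    linear_combination (v 1 : ℝ) * h1 - (u 1 : ℝ) * h2
  · refine mul_left_cancel₀ hdet ?_
    simp only [Fin.mk_one]
    linear_combination (u 0 : ℝ) * h2 - (v 0 : ℝ) * h1

/-- Every column of `{0,1}²`, twice. -/
def octagonMatrix : Matrix (Fin 2) (Fin 8) ℤ :=
  !![1, 1, 1, 1, 0, 0, 0, 0; 1, 1, 0, 0, 1, 1, 0, 0]

/-- The vertices of the projection of the uniform matroid of rank `3` by `octagonMatrix`. -/
def octagon : Finset (Fin 2 → ℤ) :=
  {![3, 2], ![2, 3], ![1, 3], ![0, 2], ![0, 1], ![1, 0], ![2, 0], ![3, 1]}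

lemma isBinary_octagonMatrix : IsBinary octagonMatrix := by
  intro i j
  fin_cases i <;> fin_cases j <;> simp [octagonMatrix]

lemma octagonMatrix_mulVec (x : Fin 8 → ℤ) :
    octagonMatrix.mulVec x = ![x 0 + x 1 + x 2 + x 3, x 0 + x 1 + x 4 + x 5] := by
  ext i
  fin_cases i <;> simp [octagonMatrix, Matrix.mulVec, dotProduct, Fin.sum_univ_eight]

/-- With every column doubled and rank 3, a generic direction selects its best column twice and its
second best once. The best is any of four corners of the square and the second an adjacent corner,
which gives eight points. Each is certified by the outer normals `u`, `v` of its two edges. -/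
lemma octagon_subset_vertices :
    toReal '' (octagon : Set (Fin 2 → ℤ)) ⊆ vertices octagonMatrix
      {x : Fin 8 → ℤ | (∀ i, x i = 0 ∨ x i = 1) ∧ ∑ i, x i = (3 : ℕ)} := by
  have key : ∀ (x : Fin 8 → ℤ) (u₀ u₁ v₀ v₁ : ℤ), ((∀ i, x i = 0 ∨ x i = 1) ∧ ∑ i, x i = 3) →
      u₀ * v₁ - u₁ * v₀ ≠ 0 →
      (∀ y : Fin 8 → ℤ, (∀ i, 0 ≤ y i ∧ y i ≤ 1) →
        y 0 + y 1 + y 2 + y 3 + y 4 + y 5 + y 6 + y 7 = 3 →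
        u₀ * (y 0 + y 1 + y 2 + y 3) + u₁ * (y 0 + y 1 + y 4 + y 5) ≤
          u₀ * (x 0 + x 1 + x 2 + x 3) + u₁ * (x 0 + x 1 + x 4 + x 5) ∧
        v₀ * (y 0 + y 1 + y 2 + y 3) + v₁ * (y 0 + y 1 + y 4 + y 5) ≤
          v₀ * (x 0 + x 1 + x 2 + x 3) + v₁ * (x 0 + x 1 + x 4 + x 5)) →
      toReal ![x 0 + x 1 + x 2 + x 3, x 0 + x 1 + x 4 + x 5] ∈ vertices octagonMatrix
        {x : Fin 8 → ℤ | (∀ i, x i = 0 ∨ x i = 1) ∧ ∑ i, x i = (3 : ℕ)} := by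
    intro x u₀ u₁ v₀ v₁ hx huv h
    have h' : ∀ y : Fin 8 → ℤ, ((∀ i, y i = 0 ∨ y i = 1) ∧ ∑ i, y i = 3) → _ :=
      fun y hy => h y (fun i => by rcases hy.1 i with h | h <;> simp [h])
        (by rw [← hy.2, Fin.sum_univ_eight])
    rw [← octagonMatrix_mulVec]
    refine toReal_mulVec_mem_vertices hx ![u₀, u₁] ![v₀, v₁] huv ?_ ?_
    · intro y hy
      simpa [octagonMatrix_mulVec, dotProduct, Fin.sum_univ_two] using (h' y hy).1
    · intro y hy
      simpa [octagonMatrix_mulVec, dotProduct, Fin.sum_univ_two] using (h' y hy).2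
  -- Named integer coordinates turn the two optimality claims into linear arithmetic over a box.
  have run : ∀ (x : Fin 8 → ℤ) (p₀ p₁ u₀ u₁ v₀ v₁ : ℤ),
      ((∀ i, x i = 0 ∨ x i = 1) ∧ ∑ i, x i = 3) →
      u₀ * v₁ - u₁ * v₀ ≠ 0 → x 0 + x 1 + x 2 + x 3 = p₀ → x 0 + x 1 + x 4 + x 5 = p₁ →
      (∀ a b c d e f g h : ℤ, 0 ≤ a → a ≤ 1 → 0 ≤ b → b ≤ 1 → 0 ≤ c → c ≤ 1 → 0 ≤ d → d ≤ 1 →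
        0 ≤ e → e ≤ 1 → 0 ≤ f → f ≤ 1 → 0 ≤ g → g ≤ 1 → 0 ≤ h → h ≤ 1 →
        a + b + c + d + e + f + g + h = 3 →
        u₀ * (a + b + c + d) + u₁ * (a + b + e + f) ≤ u₀ * p₀ + u₁ * p₁ ∧
        v₀ * (a + b + c + d) + v₁ * (a + b + e + f) ≤ v₀ * p₀ + v₁ * p₁) →
      toReal ![p₀, p₁] ∈ vertices octagonMatrix
        {x : Fin 8 → ℤ | (∀ i, x i = 0 ∨ x i = 1) ∧ ∑ i, x i = (3 : ℕ)} := by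
    rintro x _ _ u₀ u₁ v₀ v₁ hx huv rfl rfl h
    exact key x u₀ u₁ v₀ v₁ hx huv fun y hy hs =>
      h _ _ _ _ _ _ _ _ (hy 0).1 (hy 0).2 (hy 1).1 (hy 1).2 (hy 2).1 (hy 2).2 (hy 3).1 (hy 3).2
        (hy 4).1 (hy 4).2 (hy 5).1 (hy 5).2 (hy 6).1 (hy 6).2 (hy 7).1 (hy 7).2 hs
  rintro _ ⟨p, hp, rfl⟩
  simp only [octagon, Finset.coe_insert, Finset.coe_singleton, Set.mem_insert_iff,
    Set.mem_singleton_iff] at hp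
  rcases hp with rfl | rfl | rfl | rfl | rfl | rfl | rfl | rfl
  · exact run ![1, 1, 1, 0, 0, 0, 0, 0] _ _ 1 0 1 1 (by decide) (by decide) (by decide)
      (by decide) (by intros; omega)
  · exact run ![1, 1, 0, 0, 1, 0, 0, 0] _ _ 0 1 1 1 (by decide) (by decide) (by decide)
      (by decide) (by intros; omega)
  · exact run ![1, 0, 0, 0, 1, 1, 0, 0] _ _ 0 1 (-1) 1 (by decide) (by decide) (by decide)
      (by decide) (by intros; omega)
  · exact run ![0, 0, 0, 0, 1, 1, 1, 0] _ _ (-1) 0 (-1) 1 (by decide) (by decide) (by decide)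
      (by decide) (by intros; omega)
  · exact run ![0, 0, 0, 0, 1, 0, 1, 1] _ _ (-1) 0 (-1) (-1) (by decide) (by decide) (by decide)
      (by decide) (by intros; omega)
  · exact run ![0, 0, 1, 0, 0, 0, 1, 1] _ _ 0 (-1) (-1) (-1) (by decide) (by decide) (by decide)
      (by decide) (by intros; omega)
  · exact run ![0, 0, 1, 1, 0, 0, 1, 0] _ _ 0 (-1) 1 (-1) (by decide) (by decide) (by decide)
      (by decide) (by intros; omega)
  · exact run ![1, 0, 1, 1, 0, 0, 0, 0] _ _ 1 0 1 (-1) (by decide) (by decide) (by decide)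
      (by decide) (by intros; omega)

lemma eight_le_encard_vertices :
    8 ≤ (vertices octagonMatrix
      {x : Fin 8 → ℤ | (∀ i, x i = 0 ∨ x i = 1) ∧ ∑ i, x i = (3 : ℕ)}).encard := by
  refine le_trans (le_of_eq ?_) (Set.encard_le_encard octagon_subset_vertices)
  rw [toReal_injective.encard_image, Set.encard_coe_eq_coe_finsetCard,
    show octagon.card = 8 by decide]
  rfl

end ConvexMatroid

/-! ### The theorem -/

open ConvexMatroid in
theorem corollary4p7 :
    -- the maximum number of vertices of `conv(WS)` is `8`
    IsGreatest
      {k : ℕ∞ | ∃ (n : ℕ) (S : Set (Fin n → ℤ)) (W : Matrix (Fin 2) (Fin n) ℤ),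
        ConvexMatroid.IsMatroid S ∧ ConvexMatroid.IsBinary W ∧
          k = (ConvexMatroid.vertices W S).encard} 8 ∧
    -- eight fixed linear functions of the plane give the linear counterparts
    ∃ H : List (Fin 2 → ℤ), H.length = 8 ∧
      ∀ (n : ℕ) (S : Set (Fin n → ℤ)) (W : Matrix (Fin 2) (Fin n) ℤ) (f : (Fin 2 → ℝ) → ℝ)
        (o : (Fin n → ℤ) → Bool) (c : (Fin 2 → ℤ) → (Fin 2 → ℤ) → Bool),
        ConvexMatroid.IsMatroid S → ConvexMatroid.IsBinary W → ConvexOn ℝ Set.univ f →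
        ConvexMatroid.IsIndependenceOracle S o → ConvexMatroid.IsComparisonOracle f c →
        -- each linear counterpart is solved by the greedy algorithm
        (∀ h ∈ H,
          ConvexMatroid.Solves (fun x => Matrix.vecMul h W ⬝ᵥ x) S
            ((ConvexMatroid.greedy (Matrix.vecMul h W)).output o c) ∧
          (ConvexMatroid.greedy (Matrix.vecMul h W)).indepQueries o c = n) ∧
        -- the best of the eight points found solves the convex problem
        ConvexMatroid.Solves (fun x => f (ConvexMatroid.toReal (W.mulVec x))) S
          ((ConvexMatroid.convexMax H W).output o c) ∧
        (ConvexMatroid.convexMax H W).indepQueries o c = 8 * n ∧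
        (ConvexMatroid.convexMax H W).lessQueries o c = 7 := by
  refine ⟨⟨?_, ?_⟩, directions, rfl, ?_⟩
  · have hM := isMatroid_uniform (n := 8) (r := 3) (by norm_num)
    have hW := isBinary_octagonMatrix
    refine ⟨8, _, octagonMatrix, hM, hW, eight_le_encard_vertices.antisymm ?_⟩
    obtain ⟨M, -, hS⟩ := hM
    rw [hS]
    exact encard_vertices_le M hW
  · rintro _ ⟨n, _, W, ⟨M, -, rfl⟩, hW, rfl⟩
    exact encard_vertices_le M hW
  · rintro n _ W f o c ⟨M, -, rfl⟩ hW hf ho hc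
    obtain ⟨B, hB⟩ := M.exists_isBase
    have hmem : ∀ h, (greedy (Matrix.vecMul h W)).output o c ∈ baseVectors M := fun h =>
      (greedy_optimal c ho (Matrix.vecMul h W) (fun i => ((Matrix.vecMul h W i : ℤ) : ℝ))
        (fun i j hij => by exact_mod_cast hij) ⟨B, hB, rfl⟩).1
    refine ⟨fun h _ => ⟨⟨hmem h, fun y hy => ?_⟩, (greedy_queries o c _).1⟩, ?_⟩
    · have := (greedy_optimal c ho (Matrix.vecMul h W)
        (fun i => ((Matrix.vecMul h W i : ℤ) : ℝ)) (fun i j hij => by exact_mod_cast hij) hy).2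
      simp only [dotProduct]
      exact_mod_cast this
    have hout := solveCounterparts_output (W := W) o c directions
    have hq := solveCounterparts_queries (W := W) o c directions
    obtain ⟨x, l, hxl⟩ : ∃ x l, (directions.map fun h =>
        (greedy (Matrix.vecMul h W)).output o c) = x :: l := ⟨_, _, rfl⟩
    have hlen : l.length = 7 := by
      have := congrArg List.length hxl
      simpa [directions] using this.symm
    rw [hxl] at hout
    obtain ⟨hbest, hmax⟩ := pickBest_output o (W := W) hc x l
    have hpick := pickBest_queries o c (W := W) x l
    simp only [convexMax, Program.output_bind, Program.indepQueries_bind,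
      Program.lessQueries_bind, hout, hq, hpick, hlen]
    refine ⟨⟨?_, fun y hy => ?_⟩, rfl, trivial⟩
    · rw [← hxl] at hbest
      obtain ⟨h, -, hh⟩ := List.mem_map.1 hbest
      rw [← hh]
      exact hmem h
    -- By convexity, `f` at a point of the hull is at most its value at some generating greedy
    -- point.
    · obtain ⟨_, ⟨h, hh, rfl⟩, hle⟩ := hf.exists_ge_of_mem_convexHull (Set.subset_univ _)
        (projection_subset_convexHull_greedyPoint c hW ho
          (subset_convexHull ℝ _ ⟨y, hy, rfl⟩))
      refine hle.trans (hmax _ ?_)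
      rw [← hxl]
      exact List.mem_map.2 ⟨h, hh, rfl⟩
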